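/- Let $R$ be an associative ring with $1$; modules are right $R$-modules, and $\mathrm{fpmod}(R)$ is the category of finitely presented ones. A nonempty full subcategory $\mathcal S$ of $\mathrm{fpmod}(R)$ whose objects have homological (projective) dimension at most $1$ is called \emph{pre-localising} if it is closed under extensions (for every short exact sequence $0\to A\to B\to C\to 0$ with $A,C\in\mathcal S$ one has $B\in\mathcal S$), under kernels of surjective maps, and under those cokernels of injective maps that have homological dimension at most $1$, and if, for every map $\phi\colon A\to B$ in $\mathcal S$ whose cokernel has homological dimension at most $1$, $\operatorname{cok}\phi$ lies in $\mathcal S$, and $\operatorname{im}\phi$ and $\ker\phi$ lie in $\mathcal S$ whenever they are finitely presented. In the torsion theory generated by $\mathcal S$, a module $F$ is torsion-free if $\operatorname{Hom}(N,F)=0$ for all $N\in\mathcal S$, and a module $T$ is torsion if $\operatorname{Hom}(T,F)=0$ for every torsion-free module $F$. For a set $\Sigma$ of maps between finitely generated projective $R$-modules, let $R_\Sigma$ be the universal localisation of $R$ at $\Sigma$ (the ring obtained from $R$ by universally inverting the maps in $\Sigma$), and let $\mathcal S(\Sigma)$ be the full subcategory of $\mathrm{fpmod}(R)$ of the modules $M$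 of homological dimension at most $1$ with $M\otimes_R R_\Sigma=0=\operatorname{Tor}_1^R(M,R_\Sigma)$. \textbf{Theorem.} Let $\mathcal S$ be a pre-localising subcategory of $\mathrm{fpmod}(R)$. Assume that the kernel of any map between objects of $\mathcal S$ is a torsion module with respect to the torsion theory generated by $\mathcal S$. Let $\Sigma$ be a set of presentations of all the modules in $\mathcal S$, that is, a set of injective maps between finitely generated projective modules, each with cokernel isomorphic to a module in $\mathcal S$, such that every module in $\mathcal S$ is isomorphic to the cokernel of some map in $\Sigma$. Then $\mathcal S=\mathcal S(\Sigma)$. -/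

import Mathlib

open CategoryTheory CategoryTheory.Limits

universe u v w

namespace SevereOre

/-! Throughout, `R` is an arbitrary (associative, unital) ring and a right `R`-module is a module
over `Rᵐᵒᵖ`, so that `m r` is `MulOpposite.op r • m`. -/

section Tensor

open scoped TensorProduct

/-- The subgroup of `M ⊗[ℤ] N` generated by the elements `m r ⊗ n - m ⊗ r n`. -/
def balancedRelations (R : Type u) [Ring R] (M : Type u) [AddCommGroup M] [Module Rᵐᵒᵖ M]
    (N : Type v) [AddCommGroup N] [Module R N] : AddSubgroup (M ⊗[ℤ] N) :=
  AddSubgroup.closure {x | ∃ (m : M) (r : R) (n : N),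
    x = (MulOpposite.op r • m) ⊗ₜ[ℤ] n - m ⊗ₜ[ℤ] (r • n)}

/-- The abelian group `M ⊗_R N`, for a right `R`-module `M` and a left `R`-module `N`. -/
abbrev BalancedTensor (R : Type u) [Ring R] (M : Type u) [AddCommGroup M] [Module Rᵐᵒᵖ M]
    (N : Type v) [AddCommGroup N] [Module R N] : Type (max u v) :=
  (M ⊗[ℤ] N) ⧸ balancedRelations R M N

/-- The map `f ⊗ N : M ⊗_R N → M' ⊗_R N` induced by a homomorphism `f` of right modules. -/
noncomputable def BalancedTensor.map (R : Type u) [Ring R] {M M' : Type u}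
    [AddCommGroup M] [Module Rᵐᵒᵖ M] [AddCommGroup M'] [Module Rᵐᵒᵖ M']
    (N : Type v) [AddCommGroup N] [Module R N] (f : M →ₗ[Rᵐᵒᵖ] M') :
    BalancedTensor R M N →+ BalancedTensor R M' N :=
  QuotientAddGroup.map _ _
    (TensorProduct.map f.toAddMonoidHom.toIntLinearMap LinearMap.id).toAddMonoidHom <| by
      rw [balancedRelations, AddSubgroup.closure_le]
      rintro _ ⟨m, r, n, rfl⟩
      refine AddSubgroup.subset_closure ⟨f m, r, n, ?_⟩
      simp

theorem BalancedTensor.map_mk_tmul (R : Type u) [Ring R] {M M' : Type u}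
    [AddCommGroup M] [Module Rᵐᵒᵖ M] [AddCommGroup M'] [Module Rᵐᵒᵖ M']
    (N : Type v) [AddCommGroup N] [Module R N] (f : M →ₗ[Rᵐᵒᵖ] M') (m : M) (n : N) :
    BalancedTensor.map R N f (QuotientAddGroup.mk (m ⊗ₜ[ℤ] n)) =
      QuotientAddGroup.mk (f m ⊗ₜ[ℤ] n) := rfl

theorem BalancedTensor.hom_ext {R : Type u} [Ring R] {M : Type u} [AddCommGroup M] [Module Rᵐᵒᵖ M]
    {N : Type v} [AddCommGroup N] [Module R N] {A : Type*} [AddCommGroup A]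
    {f g : BalancedTensor R M N →+ A}
    (h : ∀ (m : M) (n : N), f (QuotientAddGroup.mk (m ⊗ₜ[ℤ] n)) =
      g (QuotientAddGroup.mk (m ⊗ₜ[ℤ] n))) : f = g := by
  refine DFunLike.ext _ _ fun x => ?_
  obtain ⟨x, rfl⟩ := QuotientAddGroup.mk_surjective x
  induction x using TensorProduct.induction_on with
  | zero => simp
  | tmul m n => exact h m n
  | add x y hx hy => rw [QuotientAddGroup.mk_add, map_add, map_add, hx, hy]

/-- The functor `- ⊗_R N` from right `R`-modules to abelian groups. -/
noncomputable def tensorFunctor (R : Type u) [Ring R] (N : Type v) [AddCommGroup N] [Module R N] :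
    ModuleCat.{u} Rᵐᵒᵖ ⥤ AddCommGrpCat.{max u v} where
  obj M := AddCommGrpCat.of (BalancedTensor R M N)
  map f := AddCommGrpCat.ofHom (BalancedTensor.map R N f.hom)
  map_id M := by
    ext1
    exact BalancedTensor.hom_ext fun m n => rfl
  map_comp f g := by
    ext1
    exact BalancedTensor.hom_ext fun m n => rfl

instance tensorFunctor_additive (R : Type u) [Ring R] (N : Type v) [AddCommGroup N] [Module R N] :
    (tensorFunctor R N).Additive where
  map_add {M M' f g} := by
    ext1
    refine BalancedTensor.hom_ext fun m n => ?_
    change (QuotientAddGroup.mk ((f.hom m + g.hom m) ⊗ₜ[ℤ] n) : BalancedTensor R M' N) =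
      QuotientAddGroup.mk (f.hom m ⊗ₜ[ℤ] n) + QuotientAddGroup.mk (g.hom m ⊗ₜ[ℤ] n)
    rw [TensorProduct.add_tmul, QuotientAddGroup.mk_add]

/-- `Tor_n^R(-, N)`, the `n`-th left derived functor of `- ⊗_R N`. -/
noncomputable def torFunctor (R : Type u) [Ring R] (N : Type v) [AddCommGroup N] [Module R N]
    (n : ℕ) : ModuleCat.{u} Rᵐᵒᵖ ⥤ AddCommGrpCat.{max u v} :=
  (tensorFunctor R N).leftDerived n

end Tensor

section UniversalLocalization

variable {R : Type u} [Ring R] {ι : Type w} {P Q : ι → ModuleCat.{u} Rᵐᵒᵖ}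

/-- Generators of the universal localisation of `R` at the family `σ i : P i → Q i`: the elements
of `R`, and for each `i`, each `q ∈ Q i` and each `f` in the dual `Hom_R(P i, R)` a symbol
standing for `f (τ i q)`, where `τ i` is the inverse of `σ i` that has to be adjoined. -/
inductive LocGen {R : Type u} [Ring R] {ι : Type w} {P Q : ι → ModuleCat.{u} Rᵐᵒᵖ}
    (σ : ∀ i, P i ⟶ Q i) : Type (max u w)
  | coeff (r : R) : LocGen σ
  | entry (i : ι) (q : Q i) (f : P i →ₗ[Rᵐᵒᵖ] R) : LocGen σ

/-- The image of `r : R` in the free ring on the generators. -/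
abbrev LocGen.c (σ : ∀ i, P i ⟶ Q i) (r : R) : FreeAlgebra ℤ (LocGen σ) :=
  FreeAlgebra.ι ℤ (LocGen.coeff r)

/-- The symbol for `f (τ i q)` in the free ring on the generators. -/
abbrev LocGen.e (σ : ∀ i, P i ⟶ Q i) (i : ι) (q : Q i) (f : P i →ₗ[Rᵐᵒᵖ] R) :
    FreeAlgebra ℤ (LocGen σ) :=
  FreeAlgebra.ι ℤ (LocGen.entry i q f)

/-- Defining relations of the universal localisation: the ring structure of `R`, the fact that
`(q, f) ↦ f (τ i q)` is `R`-linear in `q` and in `f` (so that it is given by an `R`-linear map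
`τ i : Q i → P i ⊗ R_Σ` when `P i` is finitely generated projective), and the two equations
`τ i ∘ σ i = id` and `σ i ∘ τ i = id`. -/
inductive LocRel {R : Type u} [Ring R] {ι : Type w} {P Q : ι → ModuleCat.{u} Rᵐᵒᵖ}
    (σ : ∀ i, P i ⟶ Q i) : FreeAlgebra ℤ (LocGen σ) → FreeAlgebra ℤ (LocGen σ) → Prop
  | coeff_one : LocRel σ (LocGen.c σ 1) 1
  | coeff_add (r s : R) : LocRel σ (LocGen.c σ (r + s)) (LocGen.c σ r + LocGen.c σ s)
  | coeff_mul (r s : R) : LocRel σ (LocGen.c σ (r * s)) (LocGen.c σ r * LocGen.c σ s)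
  | entry_add_left (i : ι) (q q' : Q i) (f : P i →ₗ[Rᵐᵒᵖ] R) :
      LocRel σ (LocGen.e σ i (q + q') f) (LocGen.e σ i q f + LocGen.e σ i q' f)
  | entry_add_right (i : ι) (q : Q i) (f f' : P i →ₗ[Rᵐᵒᵖ] R) :
      LocRel σ (LocGen.e σ i q (f + f')) (LocGen.e σ i q f + LocGen.e σ i q f')
  | entry_mul_right (i : ι) (q : Q i) (f : P i →ₗ[Rᵐᵒᵖ] R) (r : R) :
      LocRel σ (LocGen.e σ i (MulOpposite.op r • q) f) (LocGen.e σ i q f * LocGen.c σ r)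
  | entry_mul_left (i : ι) (q : Q i) (f : P i →ₗ[Rᵐᵒᵖ] R) (r : R) :
      LocRel σ (LocGen.e σ i q (r • f)) (LocGen.c σ r * LocGen.e σ i q f)
  | left_inverse (i : ι) (p : P i) (f : P i →ₗ[Rᵐᵒᵖ] R) :
      LocRel σ (LocGen.e σ i ((σ i).hom p) f) (LocGen.c σ (f p))
  | right_inverse (i : ι) (q : Q i) (g : Q i →ₗ[Rᵐᵒᵖ] R) :
      LocRel σ (LocGen.e σ i q (g ∘ₗ (σ i).hom)) (LocGen.c σ (g q))

/-- The universal localisation `R_Σ` of `R` at a family `Σ` of maps `σ i : P i → Q i` between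
finitely generated projective right modules: the ring obtained from `R` by universally adjoining
inverses to the maps `σ i`. -/
def UniversalLocalization (σ : ∀ i, P i ⟶ Q i) : Type (max u w) :=
  RingQuot (LocRel σ)

noncomputable instance (σ : ∀ i, P i ⟶ Q i) : Ring (UniversalLocalization σ) :=
  inferInstanceAs (Ring (RingQuot (LocRel σ)))

/-- The canonical ring homomorphism `R → R_Σ`. -/
noncomputable def toUniversalLocalization (σ : ∀ i, P i ⟶ Q i) :
    R →+* UniversalLocalization σ :=
  RingHom.mk'
    { toFun := fun r => RingQuot.mkRingHom (LocRel σ) (LocGen.c σ r)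
      map_one' := by
        rw [RingQuot.mkRingHom_rel (LocRel.coeff_one (σ := σ)), map_one]
        rfl
      map_mul' := fun r s => by
        rw [RingQuot.mkRingHom_rel (LocRel.coeff_mul (σ := σ) r s), map_mul]
        rfl }
    (fun r s => by
      change RingQuot.mkRingHom (LocRel σ) (LocGen.c σ (r + s)) =
        RingQuot.mkRingHom (LocRel σ) (LocGen.c σ r) + RingQuot.mkRingHom (LocRel σ) (LocGen.c σ s)
      rw [RingQuot.mkRingHom_rel (LocRel.coeff_add (σ := σ) r s), map_add])

/-- `R_Σ` as a left `R`-module. -/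
noncomputable instance (σ : ∀ i, P i ⟶ Q i) : Module R (UniversalLocalization σ) :=
  Module.compHom _ (toUniversalLocalization σ)

/-- The category `S(Σ)` of `R_Σ`-trivial modules: the finitely presented right modules `M` of
homological dimension at most `1` such that `M ⊗_R R_Σ = 0 = Tor_1^R(M, R_Σ)`. -/
def trivialModules (σ : ∀ i, P i ⟶ Q i) : ObjectProperty (ModuleCat.{u} Rᵐᵒᵖ) := fun M =>
  Module.FinitePresentation Rᵐᵒᵖ M ∧ HasProjectiveDimensionLE M 1 ∧
    IsZero ((tensorFunctor R (UniversalLocalization σ)).obj M) ∧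
    IsZero ((torFunctor R (UniversalLocalization σ) 1).obj M)

end UniversalLocalization

section Subcategories

variable {R : Type u} [Ring R]

/-- `f : A → B` is a presentation of `M`: an injective map between finitely generated projective
modules whose cokernel is isomorphic to `M`. -/
structure IsPresentation {A B : ModuleCat.{u} Rᵐᵒᵖ} (f : A ⟶ B) (M : ModuleCat.{u} Rᵐᵒᵖ) :
    Prop where
  finite_source : Module.Finite Rᵐᵒᵖ A
  projective_source : Module.Projective Rᵐᵒᵖ A
  finite_target : Module.Finite Rᵐᵒᵖ B
  projective_target : Module.Projective Rᵐᵒᵖ B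
  injective : Function.Injective f.hom
  cokernel_iso : Nonempty ((B ⧸ LinearMap.range f.hom) ≃ₗ[Rᵐᵒᵖ] M)

/-- The family `σ` is a set of presentations of all the modules in `S`. -/
structure IsPresentationFamily {ι : Type w} {P Q : ι → ModuleCat.{u} Rᵐᵒᵖ}
    (σ : ∀ i, P i ⟶ Q i) (S : ObjectProperty (ModuleCat.{u} Rᵐᵒᵖ)) : Prop where
  presents : ∀ i, ∃ M, S M ∧ IsPresentation (σ i) M
  exhausts : ∀ M, S M → ∃ i, IsPresentation (σ i) M

/-- Pre-localising subcategories: (nonempty) full subcategories of the category of finitely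
presented right modules, with objects of homological dimension at most `1`, which are closed under
extensions, kernels of surjective maps, and cokernels of injective maps when the cokernel has
homological dimension at most `1`, and such that for each map `f` between objects of `S` whose
cokernel has homological dimension at most `1`, the cokernel lies in `S`, and the image and the
kernel lie in `S` whenever they are finitely presented. -/
structure IsPreLocalising (S : ObjectProperty (ModuleCat.{u} Rᵐᵒᵖ)) : Prop where
  nonempty : ∃ M, S M
  finitePresentation : ∀ M, S M → Module.FinitePresentation Rᵐᵒᵖ M
  projectiveDimension : ∀ M, S M → HasProjectiveDimensionLE M 1
  extension : ∀ E : ShortComplex (ModuleCat.{u} Rᵐᵒᵖ), E.ShortExact → S E.X₁ → S E.X₃ → S E.X₂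
  kernel_of_surjective : ∀ E : ShortComplex (ModuleCat.{u} Rᵐᵒᵖ), E.ShortExact →
    S E.X₂ → S E.X₃ → S E.X₁
  cokernel_of_injective : ∀ E : ShortComplex (ModuleCat.{u} Rᵐᵒᵖ), E.ShortExact →
    S E.X₁ → S E.X₂ → HasProjectiveDimensionLE E.X₃ 1 → S E.X₃
  of_map : ∀ (A B : ModuleCat.{u} Rᵐᵒᵖ) (f : A ⟶ B), S A → S B →
    HasProjectiveDimensionLE (ModuleCat.of Rᵐᵒᵖ (B ⧸ LinearMap.range f.hom)) 1 →
    S (ModuleCat.of Rᵐᵒᵖ (B ⧸ LinearMap.range f.hom)) ∧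
    (Module.FinitePresentation Rᵐᵒᵖ (LinearMap.range f.hom) →
      S (ModuleCat.of Rᵐᵒᵖ (LinearMap.range f.hom))) ∧
    (Module.FinitePresentation Rᵐᵒᵖ (LinearMap.ker f.hom) →
      S (ModuleCat.of Rᵐᵒᵖ (LinearMap.ker f.hom)))

/-- Torsion-free modules of the torsion theory generated by `S`. -/
def torsionFree (S : ObjectProperty (ModuleCat.{u} Rᵐᵒᵖ)) :
    ObjectProperty (ModuleCat.{u} Rᵐᵒᵖ) := fun F =>
  ∀ N, S N → ∀ f : N ⟶ F, f = 0

/-- Torsion modules of the torsion theory generated by `S`. -/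
def torsion (S : ObjectProperty (ModuleCat.{u} Rᵐᵒᵖ)) :
    ObjectProperty (ModuleCat.{u} Rᵐᵒᵖ) := fun T =>
  ∀ F, torsionFree S F → ∀ f : T ⟶ F, f = 0

end Subcategories

end SevereOre

/-! One inclusion is formal. A module `M` in `S` is the cokernel of some injective `σ i`, and `σ i`
becomes invertible over `R_Σ`. Its cokernel and kernel there are `M ⊗ R_Σ` and `Tor₁(M, R_Σ)`, so
both vanish.

For the converse, the key claim is `trace_eq_top`: if `X ⊗ R_Σ = 0`, then `X` is a sum of images of
objects of `S`. The quotient of `X` by that sum is torsion-free (`torsionFree_quotient_trace`). A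
torsion-free module embeds in a local module `Y`, one for which every map `P i → Y` extends uniquely
along `σ i` (`exists_local`). Unique extension makes `R_Σ` act on `Y`, so each map `X → Y` factors
through `X ⊗ R_Σ = 0`, and the quotient is zero. The embedding is a countable union of steps: adjoin
the missing extensions, then divide by the trace. The hypothesis on kernels ensures that this
division does not damage the module already there (`exists_step`).

Now let `M` be in `S(Σ)`. By the claim there is a surjection `N → M` with `N` in `S`. Its kernel is
finitely generated, and vanishes over `R_Σ` because `Tor₁(M, R_Σ) = 0` (`subsingleton_tensor_ker`).
By the claim again the kernel is the image of some `N'` in `S`. Hence `M` is the cokernel of a map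
`N' → N` in `S` and has dimension at most one, so it lies in `S`. -/

namespace SevereOre

/-! ### Closure properties of `S` and the torsion-free quotient by the trace. -/

section PreLocalising

variable {R : Type u} [Ring R] {S : ObjectProperty (ModuleCat.{u} Rᵐᵒᵖ)}

/-- An exact sequence of linear maps as a short exact sequence in the category of modules. -/
theorem shortExact_of_linearMap {A B C : ModuleCat.{u} Rᵐᵒᵖ} (f : A →ₗ[Rᵐᵒᵖ] B)
    (g : B →ₗ[Rᵐᵒᵖ] C) (hf : Function.Injective f) (hg : Function.Surjective g)
    (h : LinearMap.range f = LinearMap.ker g) :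
    (ShortComplex.mk (ModuleCat.ofHom f) (ModuleCat.ofHom g)
      (ModuleCat.hom_ext (LinearMap.range_le_ker_iff.1 h.le))).ShortExact where
  exact := (ShortComplex.moduleCat_exact_iff_range_eq_ker _).2 h
  mono_f := (ModuleCat.mono_iff_injective _).2 hf
  epi_g := (ModuleCat.epi_iff_surjective _).2 hg

theorem IsPreLocalising.zero_mem (hS : IsPreLocalising S) : S (ModuleCat.of Rᵐᵒᵖ PUnit) := by
  obtain ⟨M, hM⟩ := hS.nonempty
  refine hS.kernel_of_surjective _ (shortExact_of_linearMap (A := .of _ PUnit) (B := M) (C := M)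
    0 LinearMap.id (fun _ _ _ => rfl) Function.surjective_id ?_) hM hM
  simp

theorem IsPreLocalising.extension_mem (hS : IsPreLocalising S) {A B C : ModuleCat.{u} Rᵐᵒᵖ}
    (f : A →ₗ[Rᵐᵒᵖ] B) (g : B →ₗ[Rᵐᵒᵖ] C) (hf : Function.Injective f)
    (hg : Function.Surjective g) (h : LinearMap.range f = LinearMap.ker g) (hA : S A) (hC : S C) :
    S B :=
  hS.extension _ (shortExact_of_linearMap f g hf hg h) hA hC

theorem IsPreLocalising.of_equiv (hS : IsPreLocalising S) {A B : ModuleCat.{u} Rᵐᵒᵖ}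
    (e : A ≃ₗ[Rᵐᵒᵖ] B) (hA : S A) : S B :=
  hS.extension_mem (C := .of _ PUnit) e.toLinearMap 0 e.injective
    (fun _ => ⟨0, rfl⟩) (by simp) hA hS.zero_mem

theorem IsPreLocalising.prod_mem (hS : IsPreLocalising S) {A B : ModuleCat.{u} Rᵐᵒᵖ} (hA : S A)
    (hB : S B) : S (ModuleCat.of Rᵐᵒᵖ (A × B)) :=
  hS.extension_mem (B := .of _ (A × B)) (LinearMap.inl _ A B) (LinearMap.snd _ A B)
    LinearMap.inl_injective Prod.snd_surjective (LinearMap.range_inl _ _ _) hA hB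

/-- The intersection of finitely many kernels of maps between objects of `S` is such a kernel. -/
theorem IsPreLocalising.exists_ker_eq_iInf (hS : IsPreLocalising S) {J : Type*} (s : Finset J)
    {N : ModuleCat.{u} Rᵐᵒᵖ} (V : J → ModuleCat.{u} Rᵐᵒᵖ) (hV : ∀ j, S (V j))
    (g : ∀ j, N →ₗ[Rᵐᵒᵖ] V j) :
    ∃ N' : ModuleCat.{u} Rᵐᵒᵖ, S N' ∧ ∃ f : N →ₗ[Rᵐᵒᵖ] N',
      ∀ x, f x = 0 ↔ ∀ j ∈ s, g j x = 0 := by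
  classical
  induction s using Finset.induction_on with
  | empty => exact ⟨_, hS.zero_mem, 0, by simp⟩
  | insert j s _ ih =>
    obtain ⟨N', hN', f, hf⟩ := ih
    refine ⟨_, hS.prod_mem (hV j) hN', (g j).prod f, fun x => ?_⟩
    change (g j x, f x) = 0 ↔ _
    rw [Prod.mk_eq_zero, hf, Finset.forall_mem_insert]

/-- If `B / A` and `N` lie in `S`, so does the pushout of `B ← A → N`. -/
theorem IsPreLocalising.exists_pushout (hS : IsPreLocalising S) {A B N C : ModuleCat.{u} Rᵐᵒᵖ}
    (α : A →ₗ[Rᵐᵒᵖ] B) (hα : Function.Injective α) (e : (B ⧸ LinearMap.range α) ≃ₗ[Rᵐᵒᵖ] C)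
    (hC : S C) (hN : S N) (h : A →ₗ[Rᵐᵒᵖ] N) :
    ∃ E : ModuleCat.{u} Rᵐᵒᵖ, S E ∧ ∃ j : B →ₗ[Rᵐᵒᵖ] E,
      ∀ (M : ModuleCat.{u} Rᵐᵒᵖ) (a : N →ₗ[Rᵐᵒᵖ] M) (b : B →ₗ[Rᵐᵒᵖ] M),
        a ∘ₗ h = b ∘ₗ α → ∃ c : E →ₗ[Rᵐᵒᵖ] M, c ∘ₗ j = b := by
  let p := LinearMap.range (h.prod (-α))
  have hp (x : N × B) : x ∈ p ↔ ∃ a, h a = x.1 ∧ -α a = x.2 := by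
    simp [p, LinearMap.mem_range, Prod.ext_iff]
  let q : (N × B) ⧸ p →ₗ[Rᵐᵒᵖ] C := p.liftQ
    (e.toLinearMap ∘ₗ (LinearMap.range α).mkQ ∘ₗ LinearMap.snd _ N B) (by
      intro x hx
      obtain ⟨a, -, ha⟩ := (hp x).1 hx
      simp [← ha])
  refine ⟨.of _ ((N × B) ⧸ p), ?_, p.mkQ ∘ₗ LinearMap.inr _ N B, fun M a b hab => ?_⟩
  · refine hS.extension_mem (p.mkQ ∘ₗ LinearMap.inl _ N B) q ?_ ?_ ?_ hN hC
    · rw [← LinearMap.ker_eq_bot, LinearMap.ker_eq_bot']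
      intro n hn
      obtain ⟨a, ha, ha'⟩ := (hp _).1 ((Submodule.Quotient.mk_eq_zero p).1 hn)
      have : a = 0 := hα (by simpa using ha')
      rw [this, map_zero] at ha
      exact ha.symm
    · intro c
      obtain ⟨b, hb⟩ := Submodule.mkQ_surjective _ (e.symm c)
      refine ⟨p.mkQ (0, b), ?_⟩
      change e (Submodule.mkQ _ b) = c
      rw [hb, e.apply_symm_apply]
    · refine le_antisymm ?_ ?_
      · rintro _ ⟨n, rfl⟩
        change e (Submodule.mkQ _ (0 : B)) = 0
        simp
      · intro x hx
        obtain ⟨⟨n, b⟩, rfl⟩ := p.mkQ_surjective x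
        have hb : e (Submodule.mkQ _ b) = 0 := hx
        rw [e.map_eq_zero_iff, Submodule.mkQ_apply, Submodule.Quotient.mk_eq_zero] at hb
        obtain ⟨a, ha⟩ := hb
        -- With `b = α a`, the pairs `(n, b)` and `(n + h a, 0)` differ by the relation `(h a, -α
        -- a)`.
        refine ⟨n + h a, (Submodule.Quotient.eq p).2 ((hp _).2 ⟨a, ?_⟩)⟩
        simp [ha]
  · refine ⟨p.liftQ (a.coprod b) ?_, ?_⟩
    · intro x hx
      obtain ⟨y, hy, hy'⟩ := (hp x).1 hx
      have := LinearMap.congr_fun hab y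
      simp only [LinearMap.comp_apply] at this
      simp [← hy, ← hy', this]
    · ext x
      simp

/-- The sum of the images of all maps from objects of `S` to `M`. -/
def trace (hS : IsPreLocalising S) (M : ModuleCat.{u} Rᵐᵒᵖ) : Submodule Rᵐᵒᵖ M where
  carrier := {x | ∃ N : ModuleCat.{u} Rᵐᵒᵖ, S N ∧ ∃ f : N →ₗ[Rᵐᵒᵖ] M, x ∈ LinearMap.range f}
  zero_mem' := ⟨_, hS.zero_mem, 0, Submodule.zero_mem _⟩
  add_mem' := by
    rintro _ _ ⟨N, hN, f, n, rfl⟩ ⟨N', hN', f', n', rfl⟩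
    exact ⟨_, hS.prod_mem hN hN', f.coprod f', (n, n'), by simp⟩
  smul_mem' := by
    rintro c _ ⟨N, hN, f, hx⟩
    exact ⟨N, hN, f, Submodule.smul_mem _ c hx⟩

/-- Closure under finite products makes the images of objects of `S` a directed family. -/
theorem IsPreLocalising.exists_le_range (hS : IsPreLocalising S) {M : ModuleCat.{u} Rᵐᵒᵖ}
    (L : Submodule Rᵐᵒᵖ M) (hL : L.FG) (hLM : L ≤ trace hS M) :
    ∃ N : ModuleCat.{u} Rᵐᵒᵖ, S N ∧ ∃ f : N →ₗ[Rᵐᵒᵖ] M, L ≤ LinearMap.range f := by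
  induction L, hL using Submodule.fg_induction with
  | singleton x =>
    obtain ⟨N, hN, f, hf⟩ := hLM (Submodule.mem_span_singleton_self x)
    exact ⟨N, hN, f, (Submodule.span_singleton_le_iff_mem _ _).2 hf⟩
  | sup L₁ L₂ _ _ h₁ h₂ =>
    obtain ⟨N, hN, f, hf⟩ := h₁ (le_sup_left.trans hLM)
    obtain ⟨N', hN', f', hf'⟩ := h₂ (le_sup_right.trans hLM)
    exact ⟨_, hS.prod_mem hN hN', f.coprod f', (sup_le_sup hf hf').trans
      (LinearMap.range_coprod f f').ge⟩

variable {ι : Type w} {P Q : ι → ModuleCat.{u} Rᵐᵒᵖ} {σ : ∀ i, P i ⟶ Q i}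

/-- Closure under extensions is what prevents new maps from `S` into the quotient. A map `φ` from
`N` lifts on `Q i` to a map `b` to `M` that sends `P i` into the image of a single object `N'` of
`S`. The pushout of `Q i ← P i → N'` is an extension of `N` by `N'`, hence in `S`, and `b` factors
through it; so `b` has values in the trace. -/
theorem IsPreLocalising.torsionFree_quotient_trace (hS : IsPreLocalising S)
    (hσ : IsPresentationFamily σ S) (M : ModuleCat.{u} Rᵐᵒᵖ) :
    torsionFree S (ModuleCat.of Rᵐᵒᵖ (M ⧸ trace hS M)) := by
  intro N hN φ
  obtain ⟨i, hi⟩ := hσ.exhausts N hN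
  have := hi.finite_source
  have := hi.projective_source
  have := hi.projective_target
  obtain ⟨e⟩ := hi.cokernel_iso
  let π : Q i →ₗ[Rᵐᵒᵖ] N := e.toLinearMap ∘ₗ Submodule.mkQ _
  obtain ⟨b, hb⟩ := Module.projective_lifting_property (trace hS M).mkQ (φ.hom ∘ₗ π)
    (Submodule.mkQ_surjective _)
  have hbσ : LinearMap.range (b ∘ₗ (σ i).hom) ≤ trace hS M := by
    rintro _ ⟨p, rfl⟩
    rw [← (trace hS M).ker_mkQ, LinearMap.mem_ker]
    refine (LinearMap.congr_fun hb ((σ i).hom p)).trans ?_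
    change φ.hom (e (Submodule.mkQ _ _)) = 0
    rw [Submodule.mkQ_apply, (Submodule.Quotient.mk_eq_zero _).2 (LinearMap.mem_range_self _ p),
      map_zero, map_zero]
  obtain ⟨N', hN', f, hf⟩ := hS.exists_le_range _
    (Module.Finite.iff_fg.1 (Module.Finite.range _)) hbσ
  obtain ⟨h, hh⟩ := Module.projective_lifting_property f.rangeRestrict
    (LinearMap.codRestrict _ (b ∘ₗ (σ i).hom) fun p => hf (LinearMap.mem_range_self _ p))
    f.surjective_rangeRestrict
  obtain ⟨E, hE, j, hj⟩ := hS.exists_pushout (σ i).hom hi.injective e hN hN' h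
  obtain ⟨c, hc⟩ := hj M f b (by
    ext p
    exact congrArg Subtype.val (LinearMap.congr_fun hh p))
  ext n
  obtain ⟨q, rfl⟩ : ∃ q, π q = n := (e.surjective.comp (Submodule.mkQ_surjective _)) n
  refine (LinearMap.congr_fun hb q).symm.trans ?_
  have hq : b q ∈ trace hS M := ⟨E, hE, c, j q, LinearMap.congr_fun hc q⟩
  exact (Submodule.Quotient.mk_eq_zero _).2 hq

end PreLocalising

/-- Each generator has finite support, so one finite set of indices serves the whole image. -/
theorem exists_finset_directSum {A : Type*} [Ring A] {J : Type*} [DecidableEq J] {V : J → Type*}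
    [∀ j, AddCommGroup (V j)] [∀ j, Module A (V j)] {N : Type*} [AddCommGroup N] [Module A N]
    [Module.Finite A N] (f : N →ₗ[A] DirectSum J V) :
    ∃ s : Finset J, ∀ x j, j ∉ s → f x j = 0 := by
  classical
  suffices ∀ L : Submodule A N, L.FG → ∃ s : Finset J, ∀ x ∈ L, ∀ j, j ∉ s → f x j = 0 by
    obtain ⟨s, hs⟩ := this ⊤ Module.Finite.fg_top
    exact ⟨s, fun x => hs x trivial⟩
  intro L hL
  induction L, hL using Submodule.fg_induction with
  | singleton x =>
    refine ⟨DFinsupp.support (f x), fun y hy j hj => ?_⟩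
    obtain ⟨a, rfl⟩ := Submodule.mem_span_singleton.1 hy
    rw [map_smul, DirectSum.smul_apply, DFinsupp.notMem_support_iff.1 hj, smul_zero]
  | sup L₁ L₂ _ _ h₁ h₂ =>
    obtain ⟨s, hs⟩ := h₁
    obtain ⟨t, ht⟩ := h₂
    refine ⟨s ∪ t, fun x hx j hj => ?_⟩
    obtain ⟨y, hy, z, hz, rfl⟩ := Submodule.mem_sup.1 hx
    rw [Finset.notMem_union] at hj
    rw [map_add, DirectSum.add_apply, hs y hy j hj.1, ht z hz j hj.2, add_zero]

/-! ### Enlarging a module so that maps extend along injections with cokernel in `S`. -/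

section Extension

variable {A : Type u} [Ring A] {S : ObjectProperty (ModuleCat.{u} A)}

/-- Every map `A → X` extends along every injective map `A → B` with cokernel in `S`, after
composition with `i : X → Y`. -/
def ExtendsAlong (S : ObjectProperty (ModuleCat.{u} A)) {X Y : ModuleCat.{u} A}
    (i : X →ₗ[A] Y) : Prop :=
  ∀ (K B N : ModuleCat.{u} A) (α : K →ₗ[A] B), Function.Injective α →
    ((B ⧸ LinearMap.range α) ≃ₗ[A] N) → S N →
      ∀ h : K →ₗ[A] X, ∃ g : B →ₗ[A] Y, g ∘ₗ α = i ∘ₗ h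

/-- Index set for a set of representatives of the objects of `S`. -/
abbrev Rep (S : ObjectProperty (ModuleCat.{u} A)) : Type u :=
  Σ n : ℕ, {K : Submodule A (Fin n → A) // S (ModuleCat.of A ((Fin n → A) ⧸ K))}

/-- The representative of an isomorphism class of objects of `S`. -/
abbrev Rep.obj (k : Rep S) : ModuleCat.{u} A :=
  ModuleCat.of A ((Fin k.1 → A) ⧸ k.2.1)

theorem Rep.exists_equiv [S.IsClosedUnderIsomorphisms] {N : ModuleCat.{u} A} (hN : S N)
    [Module.Finite A N] :
    ∃ k : Rep S, Nonempty (k.obj ≃ₗ[A] N) := by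
  obtain ⟨n, f, hf⟩ := Module.Finite.exists_fin' A N
  let e := f.quotKerEquivOfSurjective hf
  exact ⟨⟨n, LinearMap.ker f, S.prop_of_iso (Y := .of A _) e.symm.toModuleIso hN⟩, ⟨e⟩⟩

/-- The pullback of `E → E / X ← W`. -/
theorem exists_pullback {X E W : ModuleCat.{u} A} (ε : X →ₗ[A] E) (hε : Function.Injective ε)
    (τ : W →ₗ[A] E ⧸ LinearMap.range ε) :
    ∃ (Y : ModuleCat.{u} A) (i : X →ₗ[A] Y) (p : Y →ₗ[A] W), Function.Injective i ∧
      LinearMap.ker p = LinearMap.range i ∧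
      ∀ (K B : ModuleCat.{u} A) (α : K →ₗ[A] B) (h : K →ₗ[A] X) (b : B →ₗ[A] E) (v : B →ₗ[A] W),
        b ∘ₗ α = ε ∘ₗ h → v ∘ₗ α = 0 → (LinearMap.range ε).mkQ ∘ₗ b = τ ∘ₗ v →
          ∃ g : B →ₗ[A] Y, g ∘ₗ α = i ∘ₗ h := by
  let Y : Submodule A (E × W) :=
    LinearMap.ker ((LinearMap.range ε).mkQ ∘ₗ LinearMap.fst A E W - τ ∘ₗ LinearMap.snd A E W)
  have hY (y) : y ∈ Y ↔ (LinearMap.range ε).mkQ y.1 = τ y.2 := by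
    simp only [Y, LinearMap.mem_ker, LinearMap.sub_apply, sub_eq_zero]
    rfl
  refine ⟨.of _ Y, LinearMap.codRestrict Y (LinearMap.inl _ _ _ ∘ₗ ε) (fun x => ?_),
    LinearMap.snd _ _ _ ∘ₗ Y.subtype, ?_, ?_, ?_⟩
  · rw [hY]
    change Submodule.Quotient.mk (ε x) = τ 0
    rw [map_zero, Submodule.Quotient.mk_eq_zero]
    exact LinearMap.mem_range_self _ x
  · intro x y hxy
    exact hε (congrArg (fun z : Y => z.1.1) hxy)
  · refine le_antisymm ?_ ?_
    · rintro ⟨⟨e, v⟩, hev⟩ hv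
      obtain rfl : v = 0 := hv
      rw [hY] at hev
      obtain ⟨x, rfl⟩ : e ∈ LinearMap.range ε :=
        (Submodule.Quotient.mk_eq_zero _).1 (hev.trans (map_zero _))
      exact ⟨x, rfl⟩
    · rintro _ ⟨x, rfl⟩
      rfl
  · intro K B α h b v hb hv hbv
    refine ⟨LinearMap.codRestrict Y (b.prod v) fun x => (hY _).2 (LinearMap.congr_fun hbv x), ?_⟩
    refine LinearMap.ext fun a => ?_
    exact Subtype.ext (Prod.ext (LinearMap.congr_fun hb a) (LinearMap.congr_fun hv a))

/-- A module `X` embeds in an extension by a direct sum of objects of `S` that splits all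
extensions of objects of `S` by `X`. -/
theorem exists_extension [S.IsClosedUnderIsomorphisms]
    (hS : ∀ N, S N → Module.Finite A N) (X : ModuleCat.{u} A) :
    ∃ (J : Type u) (V : J → ModuleCat.{u} A) (Y : ModuleCat.{u} A) (i : X →ₗ[A] Y)
      (p : Y →ₗ[A] DirectSum J fun j => V j), (∀ j, S (V j)) ∧ Function.Injective i ∧
        LinearMap.ker p = LinearMap.range i ∧ ExtendsAlong S i := by
  classical
  obtain ⟨⟨E, _, ε', _⟩⟩ := EnoughInjectives.presentation X
  let ε : X →ₗ[A] E := ε'.hom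
  have hε : Function.Injective ε := (ModuleCat.mono_iff_injective ε').1 inferInstance
  -- One summand for each map from a representative to `E / X`, so that every such map factors
  -- through `τ`.
  let J := Σ k : Rep S, k.obj →ₗ[A] (E ⧸ LinearMap.range ε)
  let V : J → ModuleCat.{u} A := fun j => j.1.obj
  let τ : (DirectSum J fun j => V j) →ₗ[A] (E ⧸ LinearMap.range ε) :=
    DirectSum.toModule A J _ fun j => j.2
  have hτ (k : Rep S) (c : k.obj →ₗ[A] E ⧸ LinearMap.range ε) :
      ∃ l : k.obj →ₗ[A] DirectSum J fun j => V j, τ ∘ₗ l = c :=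
    ⟨DirectSum.lof A J (fun j => V j) ⟨k, c⟩,
      LinearMap.ext fun x => DirectSum.toModule_lof A (φ := fun j : J => j.2) ⟨k, c⟩ x⟩
  obtain ⟨Y, i, p, hi, hp, hext⟩ :=
    exists_pullback (W := .of A (DirectSum J fun j => V j)) ε hε τ
  refine ⟨J, V, Y, i, p, fun j => j.1.2.2, hi, hp, ?_⟩
  intro K B N α hα e hN h
  have : Mono (ModuleCat.ofHom α) := (ModuleCat.mono_iff_injective _).2 hα
  -- Injectivity of `E` extends `ε ∘ h` to `B`. The induced map `B / K → E / X` lifts to the direct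
  -- sum, and the two maps together define one to the pullback.
  let b : B →ₗ[A] E := (Injective.factorThru (ModuleCat.ofHom (ε ∘ₗ h) : K ⟶ E)
    (ModuleCat.ofHom α)).hom
  have hb : b ∘ₗ α = ε ∘ₗ h :=
    congrArg ModuleCat.Hom.hom (Injective.comp_factorThru
      (ModuleCat.ofHom (ε ∘ₗ h) : K ⟶ E) (ModuleCat.ofHom α))
  have := hS N hN
  obtain ⟨k, ⟨e'⟩⟩ := Rep.exists_equiv hN
  let b' : (B ⧸ LinearMap.range α) →ₗ[A] (E ⧸ LinearMap.range ε) :=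
    Submodule.mapQ _ _ b (by rintro _ ⟨a, rfl⟩; exact ⟨h a, (LinearMap.congr_fun hb a).symm⟩)
  let e'' := e.trans e'.symm
  obtain ⟨l, hl⟩ := hτ k (b' ∘ₗ e''.symm.toLinearMap)
  refine hext K B α h b (l ∘ₗ e''.toLinearMap ∘ₗ Submodule.mkQ _) hb ?_ ?_
  · refine LinearMap.ext fun a => ?_
    have : Submodule.mkQ (LinearMap.range α) (α a) = 0 :=
      (Submodule.Quotient.mk_eq_zero _).2 (LinearMap.mem_range_self _ a)
    simp only [LinearMap.comp_apply, this, map_zero, LinearMap.zero_apply]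
  · rw [← LinearMap.comp_assoc, hl, LinearMap.comp_assoc, ← LinearMap.comp_assoc (Submodule.mkQ _),
      ← LinearEquiv.coe_trans, LinearEquiv.self_trans_symm]
    rfl

end Extension

/-! ### Embedding torsion-free modules in local modules. -/

section Embedding

variable {R : Type u} [Ring R] {S : ObjectProperty (ModuleCat.{u} Rᵐᵒᵖ)}

variable {ι : Type w} {P Q : ι → ModuleCat.{u} Rᵐᵒᵖ} {σ : ∀ i, P i ⟶ Q i}

/-- The kernel of a map between objects of `S` is torsion. -/
def TorsionKernels (S : ObjectProperty (ModuleCat.{u} Rᵐᵒᵖ)) : Prop :=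
  ∀ (A B : ModuleCat.{u} Rᵐᵒᵖ) (f : A ⟶ B), S A → S B →
    torsion S (ModuleCat.of Rᵐᵒᵖ (LinearMap.ker f.hom))

theorem IsPreLocalising.isClosedUnderIsomorphisms (hS : IsPreLocalising S) :
    S.IsClosedUnderIsomorphisms where
  of_iso e h := hS.of_equiv e.toLinearEquiv h

/-- Dividing the extension `Y` of `X` by its trace restores torsion-freeness. It remains to see that
`X` meets the trace in zero, and this is where torsion kernels enter. -/
theorem IsPreLocalising.exists_step (hS : IsPreLocalising S) (hker : TorsionKernels S)
    (hσ : IsPresentationFamily σ S) (X : ModuleCat.{u} Rᵐᵒᵖ) (hX : torsionFree S X) :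
    ∃ (Y : ModuleCat.{u} Rᵐᵒᵖ) (i : X →ₗ[Rᵐᵒᵖ] Y), torsionFree S Y ∧ Function.Injective i ∧
      ExtendsAlong S i := by
  classical
  have := hS.isClosedUnderIsomorphisms
  obtain ⟨J, V, Y, i, p, hV, hi, hp, hext⟩ := exists_extension
    (fun N hN => have := hS.finitePresentation N hN; inferInstance) X
  refine ⟨_, (trace hS Y).mkQ ∘ₗ i, hS.torsionFree_quotient_trace hσ Y, ?_, ?_⟩
  · rw [← LinearMap.ker_eq_bot, LinearMap.ker_eq_bot']
    intro x hx
    obtain ⟨N, hN, φ, n, hn⟩ := (Submodule.Quotient.mk_eq_zero _).1 hx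
    have := hS.finitePresentation N hN
    obtain ⟨s, hs⟩ := exists_finset_directSum (p ∘ₗ φ)
    -- Only finitely many components of `p ∘ φ` matter, so its kernel is the kernel of a map `f` in
    -- `S` and is therefore torsion. On it `φ` takes values in the torsion-free `X`, hence vanishes.
    obtain ⟨N', hN', f, hf⟩ := hS.exists_ker_eq_iInf s V hV
      fun j => DirectSum.component Rᵐᵒᵖ J (fun j => V j) j ∘ₗ p ∘ₗ φ
    have hf' (y : N) (hy : f y = 0) : φ y ∈ LinearMap.range i := by
      rw [← hp, LinearMap.mem_ker]
      refine DFinsupp.ext fun j => ?_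
      by_cases hj : j ∈ s
      · exact (hf y).1 hy j hj
      · exact hs y j hj
    let e := LinearEquiv.ofInjective i hi
    have h0 := hker N N' (ModuleCat.ofHom f) hN hN' X hX (ModuleCat.ofHom
      (e.symm.toLinearMap ∘ₗ LinearMap.codRestrict _ (φ ∘ₗ (LinearMap.ker f).subtype)
        fun y => hf' y y.2))
    have hnf : f n = 0 := (hf n).2 fun j _ => by
      have hpn : p (φ n) = 0 := by
        rw [← LinearMap.mem_ker, hp, hn]
        exact ⟨x, rfl⟩
      change p (φ n) j = 0
      rw [hpn]
      rfl
    have h1 : e.symm ⟨φ n, hf' n hnf⟩ = 0 :=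
      LinearMap.congr_fun (congrArg ModuleCat.Hom.hom h0) ⟨n, hnf⟩
    rw [e.symm.map_eq_zero_iff] at h1
    exact hi ((hn.symm.trans (congrArg Subtype.val h1)).trans (map_zero i).symm)
  · intro A B N α hα e hN h
    obtain ⟨g, hg⟩ := hext A B N α hα e hN h
    exact ⟨(trace hS Y).mkQ ∘ₗ g, by rw [LinearMap.comp_assoc, hg, LinearMap.comp_assoc]⟩

end Embedding

/-- The union of an increasing sequence of modules. -/
theorem exists_union {A : Type u} [Ring A] (G : ℕ → ModuleCat.{u} A) (t : ∀ n, G n →ₗ[A] G (n + 1))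
    (ht : ∀ n, Function.Injective (t n)) :
    ∃ (Y : ModuleCat.{u} A) (c : ∀ n, G n →ₗ[A] Y), (∀ n, Function.Injective (c n)) ∧
      (∀ n, c (n + 1) ∘ₗ t n = c n) ∧
      ∀ N : ModuleCat.{u} A, Module.Finite A N → ∀ φ : N →ₗ[A] Y,
        ∃ (n : ℕ) (ψ : N →ₗ[A] G n), c n ∘ₗ ψ = φ := by
  let F : ℕ ⥤ ModuleCat.{u} A := Functor.ofSequence fun n => ModuleCat.ofHom (t n)
  let f (i j : ℕ) (h : i ≤ j) : G i →ₗ[A] G j := (F.map (homOfLE h)).hom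
  have hf1 (n : ℕ) : f n (n + 1) n.le_succ = t n :=
    congrArg ModuleCat.Hom.hom (Functor.ofSequence_map_homOfLE_succ _ n)
  have hfr (i : ℕ) (x : G i) : f i i le_rfl x = x :=
    LinearMap.congr_fun (congrArg ModuleCat.Hom.hom (F.map_id i)) x
  have hft {i j k : ℕ} (hij : i ≤ j) (hjk : j ≤ k) (x : G i) :
      f j k hjk (f i j hij x) = f i k (hij.trans hjk) x :=
    (LinearMap.congr_fun (congrArg ModuleCat.Hom.hom
      (F.map_comp (homOfLE hij) (homOfLE hjk))) x).symm
  have hfi (i j : ℕ) (h : i ≤ j) : Function.Injective (f i j h) := by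
    induction j, h using Nat.le_induction with
    | base => exact fun x y hxy => by rwa [hfr, hfr] at hxy
    | succ j h ih =>
      intro x y hxy
      rw [← hft h j.le_succ, ← hft h j.le_succ, hf1] at hxy
      exact ih (ht j hxy)
  have : DirectedSystem (fun n => G n) fun i j h => f i j h :=
    ⟨fun i x => hfr i x, fun _ _ _ hij hjk x => hft hij hjk x⟩
  let c (n : ℕ) : G n →ₗ[A] Module.DirectLimit (fun n => G n) f := Module.DirectLimit.of A ℕ _ f n
  have hcf (i j : ℕ) (h : i ≤ j) (x : G i) : c j (f i j h x) = c i x :=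
    Module.DirectLimit.of_f
  have hc (n : ℕ) : Function.Injective (c n) := by
    rw [← LinearMap.ker_eq_bot, LinearMap.ker_eq_bot']
    intro x hx
    obtain ⟨j, h, hj⟩ := Module.DirectLimit.of.zero_exact hx
    exact hfi n j h (hj.trans (map_zero _).symm)
  refine ⟨.of A (Module.DirectLimit (fun n => G n) f), c, hc, fun n => ?_, fun N hN φ => ?_⟩
  · rw [← hf1]
    exact LinearMap.ext fun x => hcf _ _ _ x
  · have hfg (L : Submodule A (Module.DirectLimit (fun n => G n) f)) (hL : L.FG) :
        ∃ n, L ≤ LinearMap.range (c n) := by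
      induction L, hL using Submodule.fg_induction with
      | singleton x =>
        obtain ⟨n, y, rfl⟩ := Module.DirectLimit.exists_of x
        exact ⟨n, (Submodule.span_singleton_le_iff_mem _ _).2 ⟨y, rfl⟩⟩
      | sup L₁ L₂ _ _ h₁ h₂ =>
        obtain ⟨n, hn⟩ := h₁
        obtain ⟨m, hm⟩ := h₂
        have key {k l : ℕ} (h : k ≤ l) : LinearMap.range (c k) ≤ LinearMap.range (c l) := by
          rintro _ ⟨x, rfl⟩
          exact ⟨f k l h x, hcf _ _ _ x⟩
        exact ⟨max n m, sup_le (hn.trans (key (le_max_left _ _)))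
          (hm.trans (key (le_max_right _ _)))⟩
    obtain ⟨n, hn⟩ := hfg (LinearMap.range φ) (Module.Finite.iff_fg.1 (Module.Finite.range φ))
    let e := LinearEquiv.ofInjective (c n) (hc n)
    refine ⟨n, e.symm.toLinearMap ∘ₗ LinearMap.codRestrict _ φ fun x => hn ⟨x, rfl⟩, ?_⟩
    refine LinearMap.ext fun x => ?_
    exact congrArg Subtype.val (e.apply_symm_apply ⟨φ x, hn ⟨x, rfl⟩⟩)

section Embedding

variable {R : Type u} [Ring R] {S : ObjectProperty (ModuleCat.{u} Rᵐᵒᵖ)}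
  {ι : Type w} {P Q : ι → ModuleCat.{u} Rᵐᵒᵖ}

/-- `Y` sees all maps of the family `σ` as isomorphisms. -/
def IsLocal (σ : ∀ i, P i ⟶ Q i) (Y : ModuleCat.{u} Rᵐᵒᵖ) : Prop :=
  ∀ i, Function.Bijective fun g : Q i →ₗ[Rᵐᵒᵖ] Y => g ∘ₗ (σ i).hom

variable {σ : ∀ i, P i ⟶ Q i}

/-- Torsion-free modules embed in local modules. -/
theorem IsPreLocalising.exists_local (hS : IsPreLocalising S) (hker : TorsionKernels S)
    (hσ : IsPresentationFamily σ S) (X : ModuleCat.{u} Rᵐᵒᵖ) (hX : torsionFree S X) :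
    ∃ (Y : ModuleCat.{u} Rᵐᵒᵖ) (i : X →ₗ[Rᵐᵒᵖ] Y), Function.Injective i ∧ IsLocal σ Y := by
  choose step i htf hi hext using hS.exists_step hker hσ
  let G : ℕ → {X : ModuleCat.{u} Rᵐᵒᵖ // torsionFree S X} :=
    fun n => n.rec ⟨X, hX⟩ fun _ M => ⟨step M.1 M.2, htf M.1 M.2⟩
  obtain ⟨Y, c, hc, hct, hfac⟩ := exists_union (fun n => (G n).1) (fun n => i (G n).1 (G n).2)
    (fun n => hi _ _)
  refine ⟨Y, c 0, hc 0, fun k => ?_⟩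
  obtain ⟨N, hN, hk⟩ := hσ.presents k
  have := hk.finite_source
  have := hk.finite_target
  obtain ⟨e⟩ := hk.cokernel_iso
  constructor
  · intro g g' hgg
    rw [← sub_eq_zero]
    have h0 : LinearMap.range (σ k).hom ≤ LinearMap.ker (g - g') := by
      rintro _ ⟨p, rfl⟩
      rw [LinearMap.mem_ker, LinearMap.sub_apply, sub_eq_zero]
      exact LinearMap.congr_fun hgg p
    have hfin : Module.Finite Rᵐᵒᵖ N := Module.Finite.equiv e
    -- The difference descends to the finitely generated cokernel `N`, so it factors through one
    -- stage, which is torsion-free.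
    obtain ⟨n, ψ, hψ⟩ := hfac N hfin (Submodule.liftQ _ _ h0 ∘ₗ e.symm.toLinearMap)
    have hψ0 : ψ = 0 := congrArg ModuleCat.Hom.hom ((G n).2 N hN (ModuleCat.ofHom ψ))
    refine LinearMap.ext fun q => ?_
    have := LinearMap.congr_fun hψ (e (Submodule.mkQ _ q))
    rw [hψ0, LinearMap.comp_zero] at this
    change _ = Submodule.liftQ _ _ h0 (e.symm (e _)) at this
    rw [LinearEquiv.symm_apply_apply] at this
    exact this.symm
  · intro h
    -- `P k` is finitely generated, so `h` comes from stage `n`; the extension exists at stage `n +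
    -- 1`.
    obtain ⟨n, ψ, rfl⟩ := hfac _ inferInstance h
    obtain ⟨g, hg⟩ := hext _ (G n).2 _ _ _ (σ k).hom hk.injective e hN ψ
    refine ⟨c (n + 1) ∘ₗ g, ?_⟩
    change (c (n + 1) ∘ₗ g) ∘ₗ (σ k).hom = _
    rw [← hct n, LinearMap.comp_assoc, hg, LinearMap.comp_assoc]

end Embedding

/-! ### Universal property and right exactness of the balanced tensor product. -/

section Tensor

open scoped TensorProduct

variable {R : Type u} [Ring R] {M : Type u} [AddCommGroup M] [Module Rᵐᵒᵖ M]
  {N : Type v} [AddCommGroup N] [Module R N]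

variable (R M N) in
/-- The universal balanced map. -/
noncomputable def BalancedTensor.mk : M →+ N →+ BalancedTensor R M N :=
  AddMonoidHom.mk' (fun m => AddMonoidHom.mk' (fun n => QuotientAddGroup.mk (m ⊗ₜ[ℤ] n))
    fun n n' => by rw [TensorProduct.tmul_add, QuotientAddGroup.mk_add])
    fun m m' => by
      ext n
      change QuotientAddGroup.mk ((m + m') ⊗ₜ[ℤ] n) =
        (QuotientAddGroup.mk (m ⊗ₜ[ℤ] n) + QuotientAddGroup.mk (m' ⊗ₜ[ℤ] n) : BalancedTensor R M N)
      rw [TensorProduct.add_tmul, QuotientAddGroup.mk_add]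

theorem BalancedTensor.mk_smul (m : M) (r : R) (n : N) :
    mk R M N (MulOpposite.op r • m) n = mk R M N m (r • n) := by
  refine (QuotientAddGroup.eq_iff_sub_mem).2 (AddSubgroup.subset_closure ⟨m, r, n, rfl⟩)

theorem BalancedTensor.map_mk {M' : Type u} [AddCommGroup M'] [Module Rᵐᵒᵖ M']
    (f : M →ₗ[Rᵐᵒᵖ] M') (m : M) (n : N) :
    map R N f (mk R M N m n) = mk R M' N (f m) n := rfl

/-- The map out of the tensor product induced by a balanced map. -/
noncomputable def BalancedTensor.lift {A : Type*} [AddCommGroup A] (b : M →+ N →+ A)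
    (hb : ∀ m (r : R) n, b (MulOpposite.op r • m) n = b m (r • n)) : BalancedTensor R M N →+ A :=
  QuotientAddGroup.lift _ (TensorProduct.liftAddHom b fun r m n => by simp) <| by
    rw [balancedRelations, AddSubgroup.closure_le]
    rintro _ ⟨m, r, n, rfl⟩
    change TensorProduct.liftAddHom b _ _ = 0
    rw [map_sub, TensorProduct.liftAddHom_tmul, TensorProduct.liftAddHom_tmul, hb, sub_self]

theorem BalancedTensor.lift_mk {A : Type*} [AddCommGroup A] (b : M →+ N →+ A)
    (hb : ∀ m (r : R) n, b (MulOpposite.op r • m) n = b m (r • n)) (m : M) (n : N) :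
    lift b hb (mk R M N m n) = b m n := rfl

theorem BalancedTensor.ext_mk {A : Type*} [AddCommGroup A] {f g : BalancedTensor R M N →+ A}
    (h : ∀ m n, f (mk R M N m n) = g (mk R M N m n)) : f = g :=
  BalancedTensor.hom_ext h

theorem BalancedTensor.map_comp_apply {M' M'' : Type u} [AddCommGroup M'] [Module Rᵐᵒᵖ M']
    [AddCommGroup M''] [Module Rᵐᵒᵖ M''] (f : M →ₗ[Rᵐᵒᵖ] M') (g : M' →ₗ[Rᵐᵒᵖ] M'')
    (x : BalancedTensor R M N) : map R N (g ∘ₗ f) x = map R N g (map R N f x) :=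
  DFunLike.congr_fun (ext_mk (f := map R N (g ∘ₗ f)) (g := (map R N g).comp (map R N f))
    fun _ _ => rfl) x

theorem BalancedTensor.map_surjective {M' : Type u} [AddCommGroup M'] [Module Rᵐᵒᵖ M']
    {f : M →ₗ[Rᵐᵒᵖ] M'} (hf : Function.Surjective f) : Function.Surjective (map R N f) := by
  rw [← AddMonoidHom.range_eq_top, ← QuotientAddGroup.ker_mk' (map R N f).range,
    AddMonoidHom.ker_eq_top_iff]
  refine ext_mk fun m n => ?_
  obtain ⟨m, rfl⟩ := hf m
  exact (QuotientAddGroup.eq_zero_iff _).2 ⟨mk R M N m n, rfl⟩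

/-- Right exactness of the tensor product, when the third term vanishes. -/
theorem BalancedTensor.map_surjective_of_exact {K L : Type u} [AddCommGroup K] [Module Rᵐᵒᵖ K]
    [AddCommGroup L] [Module Rᵐᵒᵖ L] (f : K →ₗ[Rᵐᵒᵖ] L) (g : L →ₗ[Rᵐᵒᵖ] M)
    (hg : Function.Surjective g) (hfg : LinearMap.ker g ≤ LinearMap.range f)
    [Subsingleton (BalancedTensor R M N)] : Function.Surjective (map R N f) := by
  let π := QuotientAddGroup.mk' (map R N f).range
  let b : L →+ N →+ (BalancedTensor R L N ⧸ (map R N f).range) :=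
    (AddMonoidHom.compHom π).comp (mk R L N)
  -- The map to the cokernel of `f ⊗ N` kills the image of `f`, so it descends to a balanced map on
  -- `M`; it then factors through `M ⊗ N = 0`.
  have hb : g.toAddMonoidHom.ker ≤ b.ker := by
    intro l hl
    obtain ⟨k, rfl⟩ := hfg hl
    ext n
    exact (QuotientAddGroup.eq_zero_iff _).2 ⟨mk R K N k n, rfl⟩
  let b' : M →+ N →+ (BalancedTensor R L N ⧸ (map R N f).range) :=
    AddMonoidHom.liftOfSurjective g.toAddMonoidHom hg ⟨b, hb⟩
  have hb' (l : L) : b' (g l) = b l :=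
    AddMonoidHom.liftOfRightInverse_comp_apply g.toAddMonoidHom _
      (Function.rightInverse_surjInv hg) ⟨b, hb⟩ l
  have hbal (m : M) (r : R) (n : N) : b' (MulOpposite.op r • m) n = b' m (r • n) := by
    obtain ⟨l, rfl⟩ := hg m
    rw [← map_smul, hb', hb']
    exact congrArg π (mk_smul l r n)
  let c := lift b' hbal
  have hπ : π = 0 := ext_mk fun l n => by
    refine (DFunLike.congr_fun (hb' l) n).symm.trans ?_
    refine (lift_mk b' hbal (g l) n).symm.trans ?_
    exact (congrArg c (Subsingleton.elim _ 0)).trans (map_zero c)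
  intro x
  exact (QuotientAddGroup.eq_zero_iff x).1 (DFunLike.congr_fun hπ x)

end Tensor

/-! ### Dual bases, the action of `R_Σ` on local modules, and invertibility of `σ i` over `R_Σ`. -/

section DualBasis

variable {R : Type u} [Ring R]

variable (R) in
/-- The isomorphism of `R` with the regular right module. -/
def opLinearMap : R →ₗ[Rᵐᵒᵖ] Rᵐᵒᵖ where
  toFun := MulOpposite.op
  map_add' _ _ := rfl
  map_smul' _ _ := rfl

variable (R) in
/-- The isomorphism of the regular right module with `R`. -/
def unopLinearMap : Rᵐᵒᵖ →ₗ[Rᵐᵒᵖ] R where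
  toFun := MulOpposite.unop
  map_add' _ _ := rfl
  map_smul' _ _ := rfl

theorem exists_dualBasis (M : Type*) [AddCommGroup M] [Module Rᵐᵒᵖ M] [Module.Finite Rᵐᵒᵖ M]
    [Module.Projective Rᵐᵒᵖ M] :
    ∃ (n : ℕ) (p : Fin n → M) (f : Fin n → M →ₗ[Rᵐᵒᵖ] R),
      ∀ m, m = ∑ j, MulOpposite.op (f j m) • p j := by
  obtain ⟨n, f, g, -, -, hfg⟩ := Module.Finite.exists_comp_eq_id_of_projective Rᵐᵒᵖ M
  refine ⟨n, fun j => f (Pi.single j 1),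
    fun j => unopLinearMap R ∘ₗ LinearMap.proj j ∘ₗ g, fun m => ?_⟩
  conv_lhs => rw [← LinearMap.id_apply (R := Rᵐᵒᵖ) m, ← hfg, LinearMap.comp_apply,
    pi_eq_sum_univ (g m), map_sum]
  refine Finset.sum_congr rfl fun j _ => ?_
  rw [map_smul]
  congr 2
  ext k
  simp [Pi.single_apply, eq_comm]

end DualBasis

section Action

variable {R : Type u} [Ring R] {ι : Type w} {P Q : ι → ModuleCat.{u} Rᵐᵒᵖ} {σ : ∀ i, P i ⟶ Q i}

/-- The map `p ↦ y f(p)`. -/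
def orbitMap {Y : ModuleCat.{u} Rᵐᵒᵖ} {M : ModuleCat.{u} Rᵐᵒᵖ} (y : Y) (f : M →ₗ[Rᵐᵒᵖ] R) :
    M →ₗ[Rᵐᵒᵖ] Y :=
  LinearMap.toSpanSingleton Rᵐᵒᵖ Y y ∘ₗ opLinearMap R ∘ₗ f

theorem orbitMap_apply {Y : ModuleCat.{u} Rᵐᵒᵖ} {M : ModuleCat.{u} Rᵐᵒᵖ} (y : Y)
    (f : M →ₗ[Rᵐᵒᵖ] R) (p : M) : orbitMap y f p = MulOpposite.op (f p) • y := rfl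

namespace IsLocal

variable {Y : ModuleCat.{u} Rᵐᵒᵖ} (hY : IsLocal σ Y)

include hY in
theorem hom_ext {i : ι} {g g' : Q i →ₗ[Rᵐᵒᵖ] Y}
    (h : ∀ p, g ((σ i).hom p) = g' ((σ i).hom p)) : g = g' :=
  (hY i).1 (LinearMap.ext h)

/-- The unique extension along `σ i` of the map `p ↦ y f(p)`. -/
noncomputable def extend (i : ι) (f : P i →ₗ[Rᵐᵒᵖ] R) (y : Y) : Q i →ₗ[Rᵐᵒᵖ] Y :=
  ((hY i).2 (orbitMap y f)).choose

theorem extend_apply (i : ι) (f : P i →ₗ[Rᵐᵒᵖ] R) (y : Y) (p : P i) :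
    hY.extend i f y ((σ i).hom p) = MulOpposite.op (f p) • y :=
  LinearMap.congr_fun ((hY i).2 (orbitMap y f)).choose_spec p

/-- The right action on a local module of a generator of the universal localisation. -/
noncomputable def act : LocGen σ → AddMonoid.End Y
  | .coeff r => AddMonoidHom.mk' (fun y => MulOpposite.op r • y) (smul_add _)
  | .entry i q f => AddMonoidHom.mk' (fun y => hY.extend i f y q) fun y y' => by
      refine LinearMap.congr_fun (f := hY.extend i f (y + y'))
        (g := hY.extend i f y + hY.extend i f y') (hY.hom_ext fun p => ?_) q
      rw [LinearMap.add_apply, extend_apply, extend_apply, extend_apply, smul_add]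

/-- The right action on a local module of the free ring on the generators. -/
noncomputable def freeAct : FreeAlgebra ℤ (LocGen σ) →+* (AddMonoid.End Y)ᵐᵒᵖ :=
  (FreeAlgebra.lift ℤ fun x => MulOpposite.op (hY.act x)).toRingHom

theorem freeAct_c (r : R) (y : Y) :
    (hY.freeAct (LocGen.c σ r)).unop y = MulOpposite.op r • y := by
  change ((FreeAlgebra.lift ℤ fun x => MulOpposite.op (hY.act x)) (FreeAlgebra.ι ℤ _)).unop y = _
  rw [FreeAlgebra.lift_ι_apply]
  rfl

theorem freeAct_e (i : ι) (q : Q i) (f : P i →ₗ[Rᵐᵒᵖ] R) (y : Y) :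
    (hY.freeAct (LocGen.e σ i q f)).unop y = hY.extend i f y q := by
  change ((FreeAlgebra.lift ℤ fun x => MulOpposite.op (hY.act x)) (FreeAlgebra.ι ℤ _)).unop y = _
  rw [FreeAlgebra.lift_ι_apply]
  rfl

theorem freeAct_mul (a b : FreeAlgebra ℤ (LocGen σ)) (y : Y) :
    (hY.freeAct (a * b)).unop y = (hY.freeAct b).unop ((hY.freeAct a).unop y) := by
  rw [map_mul]
  rfl

theorem freeAct_add (a b : FreeAlgebra ℤ (LocGen σ)) (y : Y) :
    (hY.freeAct (a + b)).unop y = (hY.freeAct a).unop y + (hY.freeAct b).unop y := by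
  rw [map_add]
  rfl

/-- Each relation involving an inverse symbol compares two maps out of `Q i`, or evaluates one on
the image of `σ i`. Two such maps agree as soon as they agree on that image, by locality. -/
theorem freeAct_eq {a b : FreeAlgebra ℤ (LocGen σ)} (h : LocRel σ a b) :
    hY.freeAct a = hY.freeAct b := by
  refine MulOpposite.unop_injective (DFunLike.ext (F := AddMonoid.End Y) _ _ fun y => ?_)
  cases h with
  | coeff_one =>
    rw [freeAct_c, map_one, MulOpposite.op_one, one_smul]
    rfl
  | coeff_add r s => rw [freeAct_add, freeAct_c, freeAct_c, freeAct_c, MulOpposite.op_add, add_smul]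
  | coeff_mul r s =>
    rw [freeAct_mul, freeAct_c, freeAct_c, freeAct_c, MulOpposite.op_mul, mul_smul]
  | entry_add_left i q q' f => rw [freeAct_add, freeAct_e, freeAct_e, freeAct_e, map_add]
  | entry_add_right i q f f' =>
    rw [freeAct_add, freeAct_e, freeAct_e, freeAct_e, ← LinearMap.add_apply]
    refine LinearMap.congr_fun (hY.hom_ext fun p => ?_) q
    rw [LinearMap.add_apply, extend_apply, extend_apply, extend_apply, LinearMap.add_apply,
      MulOpposite.op_add, add_smul]
  | entry_mul_right i q f r => rw [freeAct_mul, freeAct_c, freeAct_e, freeAct_e, map_smul]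
  | entry_mul_left i q f r =>
    rw [freeAct_mul, freeAct_c, freeAct_e, freeAct_e]
    refine LinearMap.congr_fun (hY.hom_ext fun p => ?_) q
    rw [extend_apply, extend_apply, LinearMap.smul_apply, smul_eq_mul, MulOpposite.op_mul, mul_smul]
  | left_inverse i p f => rw [freeAct_c, freeAct_e, extend_apply]
  | right_inverse i q g =>
    rw [freeAct_c, freeAct_e, ← orbitMap_apply]
    refine LinearMap.congr_fun (hY.hom_ext fun p => ?_) q
    rw [extend_apply, orbitMap_apply, LinearMap.comp_apply]

/-- The right action of the universal localisation on a local module. -/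
noncomputable def ringAct : UniversalLocalization σ →+* (AddMonoid.End Y)ᵐᵒᵖ :=
  RingQuot.lift ⟨hY.freeAct, fun _ _ h => hY.freeAct_eq h⟩

theorem ringAct_smul (r : R) (z : UniversalLocalization σ) (y : Y) :
    (hY.ringAct (r • z)).unop y = (hY.ringAct z).unop (MulOpposite.op r • y) := by
  have h : (hY.ringAct (toUniversalLocalization σ r)).unop y = MulOpposite.op r • y := by
    refine Eq.trans ?_ (hY.freeAct_c r y)
    exact congrArg (fun x : (AddMonoid.End Y)ᵐᵒᵖ => x.unop y)
      (RingQuot.lift_mkRingHom_apply hY.freeAct (fun _ _ h => hY.freeAct_eq h) (LocGen.c σ r))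
  change (hY.ringAct (toUniversalLocalization σ r * z)).unop y = _
  rw [map_mul, ← h]
  rfl

/-- The extension `x ⊗ z ↦ h(x) z` of a map to a local module. -/
noncomputable def tensorLift {X : ModuleCat.{u} Rᵐᵒᵖ} (h : X →ₗ[Rᵐᵒᵖ] Y) :
    BalancedTensor R X (UniversalLocalization σ) →+ Y :=
  BalancedTensor.lift (AddMonoidHom.mk' (fun x => AddMonoidHom.mk'
    (fun z => (hY.ringAct z).unop (h x)) fun z z' => by rw [map_add]; rfl) fun x x' => by
      ext z
      change (hY.ringAct z).unop (h (x + x')) =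
        (hY.ringAct z).unop (h x) + (hY.ringAct z).unop (h x')
      rw [map_add, map_add]) fun x r z => by
    change (hY.ringAct z).unop (h _) = (hY.ringAct (r • z)).unop (h x)
    rw [ringAct_smul, map_smul]

include hY in
/-- A module that vanishes over the universal localisation has no maps to local modules. -/
theorem map_eq_zero {X : ModuleCat.{u} Rᵐᵒᵖ}
    [Subsingleton (BalancedTensor R X (UniversalLocalization σ))] (h : X →ₗ[Rᵐᵒᵖ] Y) : h = 0 := by
  ext x
  -- `h x` is the value of the lifted map at `x ⊗ 1`, an element of the zero group.
  have h1 : hY.tensorLift h (BalancedTensor.mk R X (UniversalLocalization σ) x 1) = h x := by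
    change (hY.ringAct 1).unop (h x) = h x
    rw [map_one]
    rfl
  rw [← h1, Subsingleton.elim (BalancedTensor.mk R X (UniversalLocalization σ) x 1) 0, map_zero]
  rfl

end IsLocal

variable (σ) in
/-- The element `f (τ i q)` of the universal localisation. -/
noncomputable def entry (i : ι) (q : Q i) (f : P i →ₗ[Rᵐᵒᵖ] R) : UniversalLocalization σ :=
  RingQuot.mkRingHom (LocRel σ) (LocGen.e σ i q f)

theorem entry_add_left (i : ι) (q q' : Q i) (f : P i →ₗ[Rᵐᵒᵖ] R) :
    entry σ i (q + q') f = entry σ i q f + entry σ i q' f :=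
  (RingQuot.mkRingHom_rel (.entry_add_left i q q' f)).trans (map_add _ _ _)

theorem entry_smul_left (i : ι) (q : Q i) (r : R) (f : P i →ₗ[Rᵐᵒᵖ] R) :
    entry σ i (MulOpposite.op r • q) f = entry σ i q f * toUniversalLocalization σ r :=
  (RingQuot.mkRingHom_rel (.entry_mul_right i q f r)).trans (map_mul _ _ _)

theorem entry_smul_right (i : ι) (q : Q i) (r : R) (f : P i →ₗ[Rᵐᵒᵖ] R) :
    entry σ i q (r • f) = toUniversalLocalization σ r * entry σ i q f :=
  (RingQuot.mkRingHom_rel (.entry_mul_left i q f r)).trans (map_mul _ _ _)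

variable (σ) in
/-- The elements `f (τ i q)` depend additively on `f`. -/
noncomputable def entryHom (i : ι) (q : Q i) : (P i →ₗ[Rᵐᵒᵖ] R) →+ UniversalLocalization σ :=
  AddMonoidHom.mk' (entry σ i q) fun f f' =>
    (RingQuot.mkRingHom_rel (.entry_add_right i q f f')).trans (map_add _ _ _)

theorem entry_map (i : ι) (p : P i) (f : P i →ₗ[Rᵐᵒᵖ] R) :
    entry σ i ((σ i).hom p) f = toUniversalLocalization σ (f p) :=
  RingQuot.mkRingHom_rel (.left_inverse i p f)

theorem entry_comp (i : ι) (q : Q i) (g : Q i →ₗ[Rᵐᵒᵖ] R) :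
    entry σ i q (g ∘ₗ (σ i).hom) = toUniversalLocalization σ (g q) :=
  RingQuot.mkRingHom_rel (.right_inverse i q g)

/-- The maps `σ i` become invertible over the universal localisation. -/
theorem map_bijective (i : ι) [Module.Finite Rᵐᵒᵖ (P i)] [Module.Projective Rᵐᵒᵖ (P i)]
    [Module.Finite Rᵐᵒᵖ (Q i)] [Module.Projective Rᵐᵒᵖ (Q i)] :
    Function.Bijective (BalancedTensor.map R (UniversalLocalization σ) (σ i).hom) := by
  obtain ⟨n, p, f, hf⟩ := exists_dualBasis (R := R) (P i)
  obtain ⟨m, q, g, hg⟩ := exists_dualBasis (R := R) (Q i)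
  let b : Q i →+ UniversalLocalization σ →+ BalancedTensor R (P i) (UniversalLocalization σ) :=
    AddMonoidHom.mk' (fun x => AddMonoidHom.mk'
      (fun z => ∑ j, BalancedTensor.mk R _ _ (p j) (entry σ i x (f j) * z)) fun z z' => by
        simp only [mul_add, map_add, Finset.sum_add_distrib]) fun x x' => by
      ext z
      simp only [AddMonoidHom.mk'_apply, AddMonoidHom.add_apply, entry_add_left, add_mul, map_add,
        Finset.sum_add_distrib]
  -- The inverse is `x ⊗ z ↦ ∑ p j ⊗ f j (τ i x) z`, with `τ i x` expanded in the dual basis of `P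
  -- i`.
  let inv := BalancedTensor.lift b fun x r z => by
    change ∑ j, BalancedTensor.mk R _ _ (p j) (entry σ i (MulOpposite.op r • x) (f j) * z) =
      ∑ j, BalancedTensor.mk R _ _ (p j)
        (entry σ i x (f j) * (toUniversalLocalization σ r * z))
    refine Finset.sum_congr rfl fun j _ => ?_
    rw [entry_smul_left, mul_assoc]
  have h1 : inv.comp (BalancedTensor.map R (UniversalLocalization σ) (σ i).hom) =
      AddMonoidHom.id _ := by
    refine BalancedTensor.ext_mk fun x z => ?_
    change ∑ j, BalancedTensor.mk R _ _ (p j) (entry σ i ((σ i).hom x) (f j) * z) =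
      BalancedTensor.mk R _ _ x z
    conv_rhs => rw [hf x, map_sum, AddMonoidHom.finsetSum_apply]
    refine Finset.sum_congr rfl fun j _ => ?_
    rw [entry_map, BalancedTensor.mk_smul]
    rfl
  have h2 : (BalancedTensor.map R (UniversalLocalization σ) (σ i).hom).comp inv =
      AddMonoidHom.id _ := by
    refine BalancedTensor.ext_mk fun x z => ?_
    change BalancedTensor.map R (UniversalLocalization σ) (σ i).hom
      (∑ j, BalancedTensor.mk R _ _ (p j) (entry σ i x (f j) * z)) = BalancedTensor.mk R _ _ x z
    simp only [map_sum, BalancedTensor.map_mk]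
    have key (j : Fin n) : BalancedTensor.mk R (Q i) (UniversalLocalization σ) ((σ i).hom (p j))
        (entry σ i x (f j) * z) = ∑ k, BalancedTensor.mk R _ _ (q k)
          (entry σ i x (g k ((σ i).hom (p j)) • f j) * z) := by
      conv_lhs => rw [hg ((σ i).hom (p j)), map_sum, AddMonoidHom.finsetSum_apply]
      refine Finset.sum_congr rfl fun k _ => ?_
      rw [entry_smul_right, BalancedTensor.mk_smul, mul_assoc]
      rfl
    -- This collects the sum over `j` into the functional `g k ∘ σ i`, to which `entry_comp`
    -- applies.
    have hσ (k : Fin m) : ∑ j, g k ((σ i).hom (p j)) • f j = g k ∘ₗ (σ i).hom := by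
      ext x
      conv_rhs => rw [hf x]
      simp
    rw [Finset.sum_congr rfl fun j _ => key j, Finset.sum_comm]
    conv_rhs => rw [hg x, map_sum, AddMonoidHom.finsetSum_apply]
    refine Finset.sum_congr rfl fun k _ => ?_
    rw [← map_sum, ← Finset.sum_mul, BalancedTensor.mk_smul]
    congr 1
    change _ = toUniversalLocalization σ (g k x) * z
    rw [← entry_comp, ← hσ]
    congr 1
    exact (map_sum (entryHom σ i x) _ _).symm
  exact ⟨Function.LeftInverse.injective (g := inv) (DFunLike.congr_fun h1),
    Function.RightInverse.surjective (g := inv) (DFunLike.congr_fun h2)⟩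

end Action
-- Computing `Tor₁` from a two-term projective resolution.
section Resolution

open scoped ZeroObject

variable {C : Type*} [Category* C] [Abelian C] {A B M : C}

/-- The objects of the complex `⋯ → 0 → A → B`. -/
noncomputable def twoTermX (A B : C) : ℕ → C
  | 0 => B
  | 1 => A
  | _ + 2 => 0

/-- The differentials of the complex `⋯ → 0 → A → B`. -/
noncomputable def twoTermD (f : A ⟶ B) : ∀ n, twoTermX A B (n + 1) ⟶ twoTermX A B n
  | 0 => f
  | _ + 1 => 0

/-- The complex `⋯ → 0 → A → B`. -/
noncomputable def twoTermComplex (f : A ⟶ B) : ChainComplex C ℕ :=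
  ChainComplex.of (twoTermX A B) (twoTermD f) fun _ => zero_comp

theorem twoTermComplex_d_one_zero (f : A ⟶ B) : (twoTermComplex f).d 1 0 = f :=
  ChainComplex.of_d (twoTermX A B) (twoTermD f) 0

theorem twoTermComplex_exactAt (f : A ⟶ B) [Mono f] (n : ℕ) :
    (twoTermComplex f).ExactAt (n + 1) := by
  rw [HomologicalComplex.exactAt_iff' _ (n + 2) (n + 1) n (by simp) (by simp)]
  cases n with
  | zero =>
    refine (ShortComplex.exact_iff_mono _ ((isZero_zero C).eq_of_src _ _)).2 ?_
    change Mono ((twoTermComplex f).d 1 0)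
    rwa [twoTermComplex_d_one_zero]
  | succ n => exact ShortComplex.exact_of_isZero_X₂ _ (isZero_zero C)

/-- The projective resolution `0 → A → B → M → 0`. -/
noncomputable def twoTermResolution [Projective A] [Projective B] (f : A ⟶ B) (g : B ⟶ M)
    (w : f ≫ g = 0) (h : (ShortComplex.mk f g w).ShortExact) : ProjectiveResolution M where
  complex := twoTermComplex f
  projective
    | 0 => inferInstanceAs (Projective B)
    | 1 => inferInstanceAs (Projective A)
    | _ + 2 => inferInstanceAs (Projective (0 : C))
  π := (ChainComplex.toSingle₀Equiv _ _).symm ⟨g, by rw [twoTermComplex_d_one_zero]; exact w⟩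
  quasiIso := ⟨fun n => by
    cases n with
    | zero =>
      have := h.mono_f
      have := h.epi_g
      rw [ChainComplex.quasiIsoAt₀_iff, ShortComplex.quasiIso_iff_of_zeros' _ rfl rfl rfl]
      refine (ShortComplex.exact_and_epi_g_iff_of_iso (ShortComplex.isoMk (Iso.refl A) (Iso.refl B)
        (Iso.refl M) ?_ ?_)).1 ⟨h.exact, h.epi_g⟩
      · exact (Category.id_comp _).trans
          ((twoTermComplex_d_one_zero f).trans (Category.comp_id f).symm)
      · exact (Category.id_comp _).trans
          ((ChainComplex.toSingle₀Equiv_symm_apply_f_zero _ _).trans (Category.comp_id g).symm)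
    | succ n =>
      have := h.mono_f
      exact (quasiIsoAt_iff_exactAt' _ _ (ChainComplex.exactAt_succ_single_obj _ _)).2
        (twoTermComplex_exactAt f n)⟩

end Resolution

section Tor

variable {R : Type u} [Ring R]

/-- The resolution `0 → A → B` has no term in degree two, so `Tor₁` is the kernel of `f ⊗ N`. -/
theorem isZero_torFunctor_one_iff (N : Type v) [AddCommGroup N] [Module R N]
    {A B M : ModuleCat.{u} Rᵐᵒᵖ} [Module.Projective Rᵐᵒᵖ A] [Module.Projective Rᵐᵒᵖ B]
    (f : A →ₗ[Rᵐᵒᵖ] B) (g : B →ₗ[Rᵐᵒᵖ] M) (hf : Function.Injective f)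
    (hg : Function.Surjective g) (hfg : LinearMap.range f = LinearMap.ker g) :
    IsZero ((torFunctor R N 1).obj M) ↔ Function.Injective (BalancedTensor.map R N f) := by
  have : Projective A := (IsProjective.iff_projective A).1 inferInstance
  have : Projective B := (IsProjective.iff_projective B).1 inferInstance
  have h := shortExact_of_linearMap f g hf hg hfg
  let P := twoTermResolution _ _ _ h
  rw [torFunctor, (P.isoLeftDerivedObj (tensorFunctor R N) 1).isZero_iff]
  change IsZero (HomologicalComplex.homology _ 1) ↔ _
  rw [← HomologicalComplex.exactAt_iff_isZero_homology,
    HomologicalComplex.exactAt_iff' _ 2 1 0 (by simp) (by simp),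
    ShortComplex.exact_iff_mono _ (((tensorFunctor R N).map_isZero (isZero_zero _)).eq_of_src _ _)]
  change Mono ((tensorFunctor R N).map ((twoTermComplex (ModuleCat.ofHom f)).d 1 0)) ↔ _
  rw [twoTermComplex_d_one_zero, AddCommGrpCat.mono_iff_injective]
  rfl

end Tor

/-! ### Vanishing over `R_Σ` and generation by `S`. -/

section Main

variable {R : Type u} [Ring R] {S : ObjectProperty (ModuleCat.{u} Rᵐᵒᵖ)}
  {ι : Type w} {P Q : ι → ModuleCat.{u} Rᵐᵒᵖ} {σ : ∀ i, P i ⟶ Q i}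

theorem isZero_tensorFunctor_iff (N : Type v) [AddCommGroup N] [Module R N]
    (M : ModuleCat.{u} Rᵐᵒᵖ) :
    IsZero ((tensorFunctor R N).obj M) ↔ Subsingleton (BalancedTensor R M N) :=
  ⟨fun h => AddCommGrpCat.subsingleton_of_isZero h,
    fun _ => AddCommGrpCat.isZero_of_subsingleton (AddCommGrpCat.of (BalancedTensor R M N))⟩

/-- `Q i ⊗ R_Σ` maps onto `M ⊗ R_Σ`, yet all of it comes from `P i ⊗ R_Σ`, which maps to zero. -/
theorem IsPresentation.subsingleton_tensor {i : ι} {M : ModuleCat.{u} Rᵐᵒᵖ}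
    (h : IsPresentation (σ i) M) : Subsingleton (BalancedTensor R M (UniversalLocalization σ)) := by
  have := h.finite_source
  have := h.projective_source
  have := h.finite_target
  have := h.projective_target
  obtain ⟨e⟩ := h.cokernel_iso
  let π : Q i →ₗ[Rᵐᵒᵖ] M := e.toLinearMap ∘ₗ Submodule.mkQ _
  have hπ : Function.Surjective π := e.surjective.comp (Submodule.mkQ_surjective _)
  have h0 (x : P i) : π ((σ i).hom x) = 0 :=
    (congrArg e ((Submodule.Quotient.mk_eq_zero _).2 (LinearMap.mem_range_self _ x))).trans
      (map_zero e)
  refine subsingleton_of_forall_eq 0 fun x => ?_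
  obtain ⟨y, rfl⟩ := BalancedTensor.map_surjective hπ x
  obtain ⟨z, rfl⟩ := (map_bijective (σ := σ) i).2 y
  rw [← BalancedTensor.map_comp_apply]
  refine DFunLike.congr_fun (f := BalancedTensor.map R _ (π ∘ₗ (σ i).hom)) (g := 0)
    (BalancedTensor.ext_mk fun p n => ?_) z
  rw [BalancedTensor.map_mk, LinearMap.comp_apply, h0, map_zero]
  rfl

/-- The modules with a presentation in the family `σ` vanish over the universal localisation. -/
theorem IsPresentation.isZero_tor {i : ι} {M : ModuleCat.{u} Rᵐᵒᵖ} (h : IsPresentation (σ i) M) :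
    IsZero ((torFunctor R (UniversalLocalization σ) 1).obj M) := by
  have := h.finite_source
  have := h.projective_source
  have := h.finite_target
  have := h.projective_target
  obtain ⟨e⟩ := h.cokernel_iso
  refine (isZero_torFunctor_one_iff _ (σ i).hom (e.toLinearMap ∘ₗ Submodule.mkQ _) h.injective
    (e.surjective.comp (Submodule.mkQ_surjective _)) ?_).2 (map_bijective i).1
  rw [LinearEquiv.ker_comp, Submodule.ker_mkQ]

/-- Modules that vanish over the universal localisation are sums of images of objects of `S`. -/
theorem IsPreLocalising.trace_eq_top (hS : IsPreLocalising S) (hker : TorsionKernels S)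
    (hσ : IsPresentationFamily σ S) (X : ModuleCat.{u} Rᵐᵒᵖ)
    [Subsingleton (BalancedTensor R X (UniversalLocalization σ))] : trace hS X = ⊤ := by
  obtain ⟨Y, i, hi, hY⟩ := hS.exists_local hker hσ _ (hS.torsionFree_quotient_trace hσ X)
  rw [eq_top_iff]
  intro x _
  refine (Submodule.Quotient.mk_eq_zero _).1 (hi ?_)
  rw [map_zero]
  exact LinearMap.congr_fun (hY.map_eq_zero (i ∘ₗ (trace hS X).mkQ)) x

/-- If `0 → K → N → M → 0` is exact, `N` and `M` vanish under the tensor product with `L` and so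
does `Tor₁(M, L)`, then `K` vanishes under the tensor product with `L`. -/
theorem subsingleton_tensor_ker (L : Type v) [AddCommGroup L] [Module R L]
    {M N : ModuleCat.{u} Rᵐᵒᵖ} [HasProjectiveDimensionLE M 1]
    (f : N →ₗ[Rᵐᵒᵖ] M) (hf : Function.Surjective f) [Subsingleton (BalancedTensor R M L)]
    [Subsingleton (BalancedTensor R N L)] (hM : IsZero ((torFunctor R L 1).obj M)) :
    Subsingleton (BalancedTensor R (LinearMap.ker f) L) := by
  obtain ⟨⟨F, g', _, _⟩⟩ := EnoughProjectives.presentation M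
  let g : F →ₗ[Rᵐᵒᵖ] M := g'.hom
  have hg : Function.Surjective g := (ModuleCat.epi_iff_surjective g').1 inferInstance
  have : Module.Projective Rᵐᵒᵖ F := (IsProjective.iff_projective F).2 inferInstance
  have hE := shortExact_of_linearMap (A := .of _ (LinearMap.ker g)) (LinearMap.ker g).subtype g
    Subtype.val_injective hg (Submodule.range_subtype _)
  have : Module.Projective Rᵐᵒᵖ (LinearMap.ker g) :=
    (IsProjective.iff_projective (ModuleCat.of Rᵐᵒᵖ (LinearMap.ker g))).2
      (projective_iff_hasProjectiveDimensionLT_one.2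
        (hE.hasProjectiveDimensionLT_X₁ 1 inferInstance ‹_›))
  have hinj : Function.Injective (BalancedTensor.map R L (LinearMap.ker g).subtype) :=
    (isZero_torFunctor_one_iff (A := .of _ (LinearMap.ker g)) L (LinearMap.ker g).subtype g
      Subtype.val_injective hg (Submodule.range_subtype _)).1 hM
  obtain ⟨t, ht⟩ := Module.projective_lifting_property f g hf
  have ht' (x : F) : f (t x) = g x := LinearMap.congr_fun ht x
  let k : LinearMap.ker g →ₗ[Rᵐᵒᵖ] LinearMap.ker f :=
    LinearMap.codRestrict _ (t ∘ₗ (LinearMap.ker g).subtype) fun x => by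
      change f (t x) = 0
      rw [ht']
      exact x.2
  -- The lift `t` gives an exact sequence `0 → ker g → ker f ⊕ F → N → 0` with second map `(y, x) ↦
  -- y - t x`. As `N ⊗ L = 0`, the first map becomes surjective after tensoring.
  have hsurj : Function.Surjective (BalancedTensor.map R L (k.prod (LinearMap.ker g).subtype)) := by
    refine BalancedTensor.map_surjective_of_exact _
      ((LinearMap.ker f).subtype.coprod (-t)) ?_ ?_
    · intro n
      obtain ⟨x, hx⟩ := hg (f n)
      refine ⟨(⟨n - t x, ?_⟩, -x), ?_⟩
      · rw [LinearMap.mem_ker, map_sub, ht', hx, sub_self]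
      · simp
    · rintro ⟨y, x⟩ h
      have hyx : (y : N) = t x := by
        rw [← sub_eq_zero]
        simpa [sub_eq_add_neg] using h
      have hx : g x = 0 := by
        rw [← ht', ← hyx]
        exact y.2
      exact ⟨⟨x, hx⟩, Prod.ext (Subtype.ext hyx.symm) rfl⟩
  refine subsingleton_of_forall_eq 0 fun x => ?_
  obtain ⟨s, hs⟩ := hsurj (BalancedTensor.map R L (LinearMap.inl Rᵐᵒᵖ (LinearMap.ker f) F) x)
  have h2 := congrArg (BalancedTensor.map R L (LinearMap.snd Rᵐᵒᵖ (LinearMap.ker f) F)) hs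
  have h1 := congrArg (BalancedTensor.map R L (LinearMap.fst Rᵐᵒᵖ (LinearMap.ker f) F)) hs
  have hzero : BalancedTensor.map R L (0 : LinearMap.ker f →ₗ[Rᵐᵒᵖ] F) = 0 :=
    BalancedTensor.ext_mk fun y l => by rw [BalancedTensor.map_mk, LinearMap.zero_apply, map_zero]; rfl
  have hid : BalancedTensor.map R L (LinearMap.id : LinearMap.ker f →ₗ[Rᵐᵒᵖ] _) =
      AddMonoidHom.id _ := BalancedTensor.ext_mk fun y l => rfl
  rw [← BalancedTensor.map_comp_apply, ← BalancedTensor.map_comp_apply, LinearMap.snd_comp_inl,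
    LinearMap.snd_prod, hzero] at h2
  -- The component in `F ⊗ L` is zero, and `ker g ⊗ L → F ⊗ L` is injective since `Tor₁(M, L) = 0`.
  have hs0 : s = 0 := hinj (h2.trans (map_zero _).symm)
  rw [← BalancedTensor.map_comp_apply, ← BalancedTensor.map_comp_apply, LinearMap.fst_comp_inl,
    hid, hs0, map_zero] at h1
  exact h1.symm

end Main

end SevereOre

theorem mainTheorem8 {R : Type u} [Ring R]
    (S : ObjectProperty (ModuleCat.{u} Rᵐᵒᵖ)) (hS : SevereOre.IsPreLocalising S)
    (hker : ∀ (A B : ModuleCat.{u} Rᵐᵒᵖ) (f : A ⟶ B), S A → S B →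
      SevereOre.torsion S (ModuleCat.of Rᵐᵒᵖ (LinearMap.ker f.hom)))
    {ι : Type w} {P Q : ι → ModuleCat.{u} Rᵐᵒᵖ} (σ : ∀ i, P i ⟶ Q i)
    (hσ : SevereOre.IsPresentationFamily σ S) :
    S = SevereOre.trivialModules σ := by
  open SevereOre in
  ext M
  constructor
  · intro hM
    obtain ⟨i, hi⟩ := hσ.exhausts M hM
    exact ⟨hS.finitePresentation M hM, hS.projectiveDimension M hM,
      (isZero_tensorFunctor_iff _ M).2 hi.subsingleton_tensor, hi.isZero_tor⟩
  · rintro ⟨hfp, hdim, htensor, htor⟩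
    have := (isZero_tensorFunctor_iff _ M).1 htensor
    have hMtop := hS.trace_eq_top hker hσ M
    obtain ⟨N, hN, f, hf⟩ := hS.exists_le_range ⊤ Module.Finite.fg_top hMtop.ge
    have hf' : Function.Surjective f := LinearMap.range_eq_top.1 (top_le_iff.1 hf)
    obtain ⟨i, hi⟩ := hσ.exhausts N hN
    have := hi.subsingleton_tensor
    have := subsingleton_tensor_ker _ f hf' htor
    have hKtop := hS.trace_eq_top hker hσ (.of _ (LinearMap.ker f))
    have := hS.finitePresentation N hN
    have hKfg : Module.Finite Rᵐᵒᵖ (LinearMap.ker f) :=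
      Module.Finite.iff_fg.2 (Module.FinitePresentation.fg_ker f hf')
    obtain ⟨N', hN', g, hg⟩ := hS.exists_le_range (M := .of _ (LinearMap.ker f)) ⊤
      Module.Finite.fg_top hKtop.ge
    let h : N' →ₗ[Rᵐᵒᵖ] N := (LinearMap.ker f).subtype ∘ₗ g
    have hrange : LinearMap.range h = LinearMap.ker f := by
      rw [LinearMap.range_comp, top_le_iff.1 hg, Submodule.map_top, Submodule.range_subtype]
    let e : (N ⧸ LinearMap.range h) ≃ₗ[Rᵐᵒᵖ] M :=
      (Submodule.quotEquivOfEq _ _ hrange).trans (f.quotKerEquivOfSurjective hf')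
    have hdim' : HasProjectiveDimensionLE (ModuleCat.of Rᵐᵒᵖ (N ⧸ LinearMap.range h)) 1 :=
      hasProjectiveDimensionLT_of_iso (e.symm.toModuleIso (X₁ := M)) 2
    -- `M` is the cokernel of `N' → N`, and its dimension bound lets the closure property for maps
    -- in `S` apply.
    exact hS.of_equiv (A := .of _ _) e (hS.of_map N' N (ModuleCat.ofHom h) hN' hN hdim').1
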